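/- A probabilistic Büchi automaton (PBA) is a tuple $\mathcal A=(Q,\Sigma,\delta,\mu_0,F)$ with finite state set $Q$, finite alphabet $\Sigma$, a probability distribution $\delta(p,a,\cdot)$ on $Q$ for all $p\in Q$, $a\in\Sigma$, an initial probability distribution $\mu_0$ on $Q$, and final states $F\subseteq Q$. On each word $w=w_0w_1\cdots\in\Sigma^\omega$ it induces the probability measure $\Pr_w$ on $Q^\omega$ of the Markov chain with initial distribution $\mu_0$ and transition probabilities $\delta(\cdot,w_n,\cdot)$ at time $n$. Its underlying nondeterministic Büchi automaton has the transitions $(p,a,q)$ with $\delta(p,a,q)>0$, the initial states $q$ with $\mu_0(q)>0$, and the final states $F$; a run on $w$ is accepting if it visits $F$ infinitely often. The trimmed underlying automaton is obtained by deleting all states that lie on no accepting run of any word. The almost-sure language $L^{=1}(\mathcal A)$ is the set of all $w\in\Sigma^\omega$ for which $\Pr_w$ gives probability $1$ to the set of accepting runs on $w$. $\mathcal A$ is at most exponentially ambiguous if on every word $w\in\Sigma^\omega$ the trimmed underlying automaton has only finitely many accepting runs. $\mathcal A$ is flat if its trimmed underlying automaton has no EDA pattern, i.e. there are no state $p$ and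 word $v\in\Sigma^*$ with two different paths from $p$ to $p$ labelled by $v$. **Theorem.** Let $\mathcal A$ be a PBA that is at most exponentially ambiguous or flat. Then $L^{=1}(\mathcal A)$ is regular (recognized by some finite nondeterministic Büchi automaton) and is recognized by some finite deterministic Büchi automaton (one with exactly one initial state and at most one successor for each state and symbol). -/

import Mathlib

open MeasureTheory ProbabilityTheory Filter

/-- A (nondeterministic) automaton `(Q, Σ, Δ, Q₀, F)` on infinite words, read with the Büchi
acceptance condition. Here `σ` is the set of states, `α` the alphabet; both are assumed to be
finite where this matters. An infinite word is a function `ℕ → α`. -/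
structure BuchiAutomaton (α : Type*) (σ : Type*) where
  /-- the transition relation: `trans p a q` means `(p, a, q) ∈ Δ` -/
  trans : σ → α → σ → Prop
  /-- the initial states -/
  init : Set σ
  /-- the final states -/
  final : Set σ

namespace BuchiAutomaton

variable {α σ : Type*} (N : BuchiAutomaton α σ)

/-- `ρ` is a run of the automaton on the infinite word `w`. -/
def IsRun (w : ℕ → α) (ρ : ℕ → σ) : Prop :=
  ρ 0 ∈ N.init ∧ ∀ i, N.trans (ρ i) (w i) (ρ (i + 1))

/-- The accepting runs on `w`: the runs that visit final states infinitely often. -/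
def acceptingRuns (w : ℕ → α) : Set (ℕ → σ) :=
  {ρ | N.IsRun w ρ ∧ ∃ᶠ i in atTop, ρ i ∈ N.final}

/-- The recognized language: all words that have an accepting run. -/
def language : Set (ℕ → α) :=
  {w | (N.acceptingRuns w).Nonempty}

/-- The automaton is deterministic: `|Q₀| = 1` and `|Δ(p, a)| ≤ 1` for all `p` and `a`. -/
def IsDeterministic : Prop :=
  (∃ q₀, N.init = {q₀}) ∧ ∀ p a, {q | N.trans p a q}.Subsingleton

/-- `π` is a path from `p` to `q` labelled by the finite word `v` (it has `|v| + 1` states). -/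
def IsPath (p : σ) (v : List α) (q : σ) (π : Fin (v.length + 1) → σ) : Prop :=
  π 0 = p ∧ π (Fin.last v.length) = q ∧
    ∀ i : Fin v.length, N.trans (π i.castSucc) (v.get i) (π i.succ)

/-- EDA pattern: some state `p` and some finite word `v` have two different paths
from `p` to `p` labelled by `v`. -/
def HasEDA : Prop :=
  ∃ (p : σ) (v : List α) (π π' : Fin (v.length + 1) → σ),
    π ≠ π' ∧ N.IsPath p v p π ∧ N.IsPath p v p π'

/-- On every word there are only finitely many accepting runs. This is the union of the classes of
finitely, polynomially and exponentially ambiguous automata. -/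
def AtMostExponentiallyAmbiguous : Prop :=
  ∀ w : ℕ → α, (N.acceptingRuns w).Finite

/-- A state is useful if some accepting run (on some word) goes through it. -/
def IsUseful (q : σ) : Prop :=
  ∃ (w : ℕ → α) (ρ : ℕ → σ), ρ ∈ N.acceptingRuns w ∧ ∃ i, ρ i = q

/-- The trimmed automaton: all states that are not useful are removed. -/
def trim : BuchiAutomaton α {q : σ // N.IsUseful q} where
  trans p a q := N.trans p.1 a q.1
  init := {q | q.1 ∈ N.init}
  final := {q | q.1 ∈ N.final}

end BuchiAutomaton

/-- A language of infinite words is regular if a finite (nondeterministic) Büchi automaton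
recognizes it. -/
def IsOmegaRegular {α : Type*} (L : Set (ℕ → α)) : Prop :=
  ∃ (σ : Type) (_ : Finite σ) (B : BuchiAutomaton α σ), B.language = L

/-- The language is recognized by a finite deterministic Büchi automaton (DBA). -/
def IsDBARecognizable {α : Type*} (L : Set (ℕ → α)) : Prop :=
  ∃ (σ : Type) (_ : Finite σ) (B : BuchiAutomaton α σ), B.IsDeterministic ∧ B.language = L

/-- A probabilistic Büchi automaton `(Q, Σ, δ, μ₀, F)`: `init` is the initial distribution `μ₀` and
`step p a` is the distribution `δ(p, a, ·)` of the successor of `p` on the symbol `a`. -/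
structure PBA (α : Type*) (σ : Type*) where
  /-- the initial distribution -/
  init : PMF σ
  /-- the transition probabilities -/
  step : σ → α → PMF σ
  /-- the final states -/
  final : Set σ

namespace PBA

variable {α σ : Type*} (A : PBA α σ)

/-- The underlying automaton: the transitions and the initial states of positive probability. -/
def underlying : BuchiAutomaton α σ where
  trans p a q := 0 < A.step p a q
  init := {q | 0 < A.init q}
  final := A.final

/-- The transition kernel at time `n` on the input word `w`: given the states at times `0, …, n`,
the next state is distributed as `δ(q, w n, ·)`, where `q` is the state at time `n`. -/
noncomputable def stepKernel [MeasurableSpace σ] [DiscreteMeasurableSpace σ] (w : ℕ → α) (n : ℕ) :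
    Kernel (Finset.Iic n → σ) σ where
  toFun h := (A.step (h ⟨n, Finset.mem_Iic.2 le_rfl⟩) (w n)).toMeasure
  measurable' := by
    have h1 : Measurable fun q : σ => (A.step q (w n)).toMeasure := Measurable.of_discrete
    exact h1.comp (measurable_pi_apply _)

instance [MeasurableSpace σ] [DiscreteMeasurableSpace σ] (w : ℕ → α) (n : ℕ) :
    IsMarkovKernel (A.stepKernel w n) :=
  ⟨fun h => PMF.toMeasure.isProbabilityMeasure (A.step (h ⟨n, Finset.mem_Iic.2 le_rfl⟩) (w n))⟩

/-- The probability measure on sequences of states that the automaton induces on the input word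
`w`: the law of the (time-inhomogeneous) Markov chain with initial distribution `init` and with
transition probabilities `step · (w n)` at time `n`. -/
noncomputable def runMeasure [MeasurableSpace σ] [DiscreteMeasurableSpace σ] (w : ℕ → α) :
    Measure (ℕ → σ) :=
  Kernel.trajMeasure (X := fun _ => σ) A.init.toMeasure (A.stepKernel w)

/-- The almost-sure language: all words `w` on which the set of accepting runs has probability `1`.
The state set carries the discrete `σ`-algebra. -/
def almostSureLanguage : Set (ℕ → α) :=
  letI : MeasurableSpace σ := ⊤
  {w | A.runMeasure w (A.underlying.acceptingRuns w) = 1}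

/-- Ambiguity of a PBA is the ambiguity of its trimmed underlying automaton. -/
def AtMostExponentiallyAmbiguous : Prop :=
  A.underlying.trim.AtMostExponentiallyAmbiguous

/-- A PBA is flat if its trimmed underlying automaton has no EDA pattern. -/
def IsFlat : Prop :=
  ¬ A.underlying.trim.HasEDA

end PBA

/-! In both cases a word is accepted almost surely iff no run on it eventually stays in a certain
set `D` of transitions, and the breakpoint construction turns any such condition into a DBA
(`isDBARecognizable_forall_run`).

Finitely many accepting runs: `D` consists of the transitions leaving nonfinal states. Every prefix
of a run has positive probability, so under almost sure acceptance some accepting run shares it. For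
a rejecting run, one of the finitely many accepting runs would share infinitely many of its
prefixes, hence equal it.

Flat: reaching a useless state has positive probability and excludes acceptance. If no run does so,
all runs live in the trimmed automaton, where the absence of EDA leaves only countably many.
Acceptance then fails with positive probability iff some rejecting run is an atom, that is, iff its
steps eventually all have probability `1`. -/

/-! ### Deterministic Büchi automata from transition functions -/

/-- The sequence of states of a deterministic transition system on the word `w`. -/
def stateSeq {α S : Type*} (δ : S → α → S) (s : S) (w : ℕ → α) : ℕ → S
  | 0 => s
  | n + 1 => δ (stateSeq δ s w n) (w n)

theorem isDBARecognizable_stateSeq {α S : Type*} [Finite S] (δ : S → α → S) (s : S) (F : Set S) :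
    IsDBARecognizable {w | ∃ᶠ n in atTop, stateSeq δ s w n ∈ F} := by
  -- `IsDBARecognizable` asks for states in `Type`, whereas `S` may live in any universe.
  let e := Finite.equivFin S
  refine ⟨Fin (Nat.card S), inferInstance,
    ⟨fun p a q => q = e (δ (e.symm p) a), {e s}, {p | e.symm p ∈ F}⟩, ⟨⟨e s, rfl⟩, ?_⟩, ?_⟩
  · intro p a q hq q' hq'
    exact Eq.trans hq (Eq.symm hq')
  · ext w
    constructor
    · rintro ⟨ρ, ⟨h0, hs⟩, hF⟩
      have key : ∀ n, e.symm (ρ n) = stateSeq δ s w n := by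
        intro n
        induction n with
        | zero => rw [show ρ 0 = e s from h0]; simp [stateSeq]
        | succ n ih => rw [show ρ (n + 1) = _ from hs n, ih]; simp [stateSeq]
      refine hF.mono fun n hn => ?_
      rw [← key n]
      exact hn
    · intro hw
      refine ⟨fun n => e (stateSeq δ s w n), ⟨rfl, fun n => ?_⟩, hw.mono fun n hn => ?_⟩
      · change _ = e (δ (e.symm (e _)) _)
        simp [stateSeq]
      · change e.symm (e _) ∈ F
        simpa using hn

theorem IsDBARecognizable.isOmegaRegular {α : Type*} {L : Set (ℕ → α)}
    (h : IsDBARecognizable L) : IsOmegaRegular L := by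
  obtain ⟨S, hS, B, -, hB⟩ := h
  exact ⟨S, hS, B, hB⟩

/-! ### The breakpoint construction -/

namespace BuchiAutomaton

variable {α σ : Type*} (N : BuchiAutomaton α σ) (D : σ → α → σ → Prop)

open Classical in
/-- The transition function of the breakpoint construction: the first component is the set of
reachable states, the second one the set of states reached by runs that have used only
transitions of `D` since the last breakpoint, i.e. since that component was empty. -/
noncomputable def breakpointStep (P : Set σ × Set σ) (a : α) : Set σ × Set σ :=
  ({q | ∃ p ∈ P.1, N.trans p a q},
    if P.2 = ∅ then {q | ∃ p ∈ P.1, N.trans p a q} else {q | ∃ p ∈ P.2, N.trans p a q ∧ D p a q})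

/-- The sequence of states of the breakpoint construction on the word `w`. -/
noncomputable def breakpointSeq (w : ℕ → α) : ℕ → Set σ × Set σ :=
  stateSeq (N.breakpointStep D) (N.init, ∅) w

variable {N D}

theorem mem_breakpointSeq_of_isRun {w : ℕ → α} {ρ : ℕ → σ} (h : N.IsRun w ρ) (n : ℕ) :
    ρ n ∈ (N.breakpointSeq D w n).1 := by
  induction n with
  | zero => exact h.1
  | succ n ih => exact ⟨ρ n, ih, h.2 n⟩

theorem exists_run_of_mem_breakpointSeq_fst {w : ℕ → α} (n : ℕ) :
    ∀ q ∈ (N.breakpointSeq D w n).1, ∃ ρ : ℕ → σ, ρ 0 ∈ N.init ∧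
      (∀ i < n, N.trans (ρ i) (w i) (ρ (i + 1))) ∧ ρ n = q := by
  induction n with
  | zero => exact fun q hq => ⟨fun _ => q, hq, by simp, rfl⟩
  | succ n ih =>
    rintro q ⟨p, hp, hpq⟩
    obtain ⟨ρ, h0, hs, rfl⟩ := ih p hp
    refine ⟨fun i => if i ≤ n then ρ i else q, by simpa using h0, fun i hi => ?_, by simp⟩
    rcases Nat.lt_succ_iff_lt_or_eq.1 hi with h | rfl
    · simpa [h.le, Nat.succ_le_of_lt h] using hs i h
    · simpa using hpq

theorem breakpointSeq_snd_subset (w : ℕ → α) (n : ℕ) :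
    (N.breakpointSeq D w n).2 ⊆ (N.breakpointSeq D w n).1 := by
  induction n with
  | zero => exact Set.empty_subset _
  | succ n ih =>
    change (N.breakpointStep D _ _).2 ⊆ (N.breakpointStep D _ _).1
    unfold breakpointStep
    split_ifs with h
    · exact subset_rfl
    · rintro q ⟨p, hp, hpq, -⟩
      exact ⟨p, ih hp, hpq⟩

/-- With no breakpoint from time `m` on, the second component is never refilled, so its members are
reached from time `m` through `D` alone. -/
theorem exists_run_of_mem_breakpointSeq_snd {w : ℕ → α} {m : ℕ}
    (hm : ∀ n, m ≤ n → (N.breakpointSeq D w n).2 ≠ ∅) (k : ℕ) :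
    ∀ q ∈ (N.breakpointSeq D w (m + k)).2, ∃ ρ : ℕ → σ, ρ 0 ∈ N.init ∧
      (∀ i < m + k, N.trans (ρ i) (w i) (ρ (i + 1)) ∧ (m ≤ i → D (ρ i) (w i) (ρ (i + 1)))) ∧
      ρ (m + k) = q := by
  induction k with
  | zero =>
    intro q hq
    obtain ⟨ρ, h0, hs, hq⟩ :=
      exists_run_of_mem_breakpointSeq_fst m q (breakpointSeq_snd_subset w m hq)
    exact ⟨ρ, h0, fun i hi => ⟨hs i hi, fun h => absurd hi h.not_gt⟩, hq⟩
  | succ k ih =>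
    intro q hq
    change q ∈ (N.breakpointStep D (N.breakpointSeq D w (m + k)) (w (m + k))).2 at hq
    unfold breakpointStep at hq
    rw [if_neg (hm _ (Nat.le_add_right m k))] at hq
    obtain ⟨p, hp, hpq, hD⟩ := hq
    obtain ⟨ρ, h0, hs, rfl⟩ := ih p hp
    refine ⟨fun i => if i ≤ m + k then ρ i else q, by simpa using h0, fun i hi => ?_, by
      simp [← add_assoc]⟩
    rcases Nat.lt_succ_iff_lt_or_eq.1 hi with h | rfl
    · have h' : i < m + k := h
      simpa [h'.le, h'] using hs i h
    · simpa using ⟨hpq, hD⟩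

/-- Forward, by contraposition: König's lemma, as compactness of `ℕ → σ`, glues the finite runs that
avoid breakpoints after `m`. Backward: a run staying in `D` enters the second component at the next
breakpoint and then keeps it nonempty. -/
theorem frequently_breakpoint_iff [Finite σ] (w : ℕ → α) :
    (∃ᶠ n in atTop, (N.breakpointSeq D w n).2 = ∅) ↔
      ¬ ∃ ρ, N.IsRun w ρ ∧ ∀ᶠ i in atTop, D (ρ i) (w i) (ρ (i + 1)) := by
  rw [← not_iff_not, not_not, not_frequently]
  constructor
  · intro h
    obtain ⟨m, hm⟩ := eventually_atTop.1 h
    let : TopologicalSpace σ := ⊥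
    have : DiscreteTopology σ := ⟨rfl⟩
    let K : ℕ → Set (ℕ → σ) := fun k => {ρ | ρ 0 ∈ N.init ∧
      ∀ i < m + k, N.trans (ρ i) (w i) (ρ (i + 1)) ∧ (m ≤ i → D (ρ i) (w i) (ρ (i + 1)))}
    have hK : ∀ k, IsClosed (K k) := by
      intro k
      have : K k = {ρ | ρ 0 ∈ N.init} ∩ ⋂ i, ⋂ (_ : i < m + k), {ρ | N.trans (ρ i) (w i)
          (ρ (i + 1)) ∧ (m ≤ i → D (ρ i) (w i) (ρ (i + 1)))} := by
        ext ρ; simp [K]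
      rw [this]
      refine IsClosed.inter ((isClosed_discrete N.init).preimage (continuous_apply 0))
        (isClosed_iInter fun i => isClosed_iInter fun _ => ?_)
      have hc : IsClosed ((fun ρ : ℕ → σ => (ρ i, ρ (i + 1))) ⁻¹' {x : σ × σ | N.trans x.1 (w i) x.2 ∧
        (m ≤ i → D x.1 (w i) x.2)}) := (isClosed_discrete _).preimage
          ((continuous_apply i).prodMk (continuous_apply (i + 1)))
      exact hc
    obtain ⟨ρ, hρ⟩ := IsCompact.nonempty_iInter_of_sequence_nonempty_isCompact_isClosed K
      (fun k ρ hρ => ⟨hρ.1, fun i hi => hρ.2 i (by omega)⟩)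
      (fun k => by
        obtain ⟨q, hq⟩ := Set.nonempty_iff_ne_empty.2 (hm (m + k) (by omega))
        obtain ⟨ρ, h0, hs, -⟩ := exists_run_of_mem_breakpointSeq_snd hm k q hq
        exact ⟨ρ, h0, hs⟩)
      (hK 0).isCompact hK
    rw [Set.mem_iInter] at hρ
    refine ⟨ρ, ⟨(hρ 0).1, fun i => ((hρ (i + 1)).2 i (by omega)).1⟩,
      eventually_atTop.2 ⟨m, fun i hi => ((hρ (i + 1)).2 i (by omega)).2 hi⟩⟩
  · rintro ⟨ρ, hρ, hD⟩
    obtain ⟨m, hm⟩ := eventually_atTop.1 hD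
    by_contra hcon
    rw [not_eventually] at hcon
    obtain ⟨n, hn, hne⟩ := frequently_atTop.1 hcon m
    rw [not_not] at hne
    -- The refill after the breakpoint at `n` takes all successors, so membership starts at time `n
    -- + 1`.
    have key : ∀ k, ρ (n + 1 + k) ∈ (N.breakpointSeq D w (n + 1 + k)).2 := by
      intro k
      induction k with
      | zero =>
        change _ ∈ (N.breakpointStep D (N.breakpointSeq D w n) (w n)).2
        unfold breakpointStep
        rw [if_pos hne]
        exact ⟨ρ n, mem_breakpointSeq_of_isRun hρ n, hρ.2 n⟩
      | succ k ih =>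
        change _ ∈ (N.breakpointStep D (N.breakpointSeq D w (n + 1 + k)) (w (n + 1 + k))).2
        unfold breakpointStep
        rw [if_neg (Set.nonempty_iff_ne_empty.1 ⟨_, ih⟩)]
        exact ⟨_, ih, hρ.2 _, hm _ (by omega)⟩
    obtain ⟨n', hn', hne'⟩ := frequently_atTop.1 hcon (n + 1)
    rw [not_not] at hne'
    obtain ⟨k, rfl⟩ := Nat.exists_eq_add_of_le hn'
    exact (hne' ▸ key k : _ ∈ (∅ : Set σ))

/-- For every set `D` of transitions of a finite automaton, the words without a run that
eventually stays in `D` form a DBA recognizable language. -/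
theorem isDBARecognizable_forall_run [Finite σ] (N : BuchiAutomaton α σ)
    (D : σ → α → σ → Prop) : IsDBARecognizable
      {w | ¬ ∃ ρ, N.IsRun w ρ ∧ ∀ᶠ i in atTop, D (ρ i) (w i) (ρ (i + 1))} := by
  have h := isDBARecognizable_stateSeq (N.breakpointStep D) (N.init, ∅) {P | P.2 = ∅}
  convert h using 3 with w
  exact (frequently_breakpoint_iff w).symm

/-! ### Useful states and counting runs -/

variable {w : ℕ → α}

/-- The states before a useful state of a run are useful. -/
theorem IsRun.isUseful_of_le {ρ : ℕ → σ} (h : N.IsRun w ρ) {i n : ℕ} (hi : i ≤ n)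
    (hn : N.IsUseful (ρ n)) : N.IsUseful (ρ i) := by
  obtain ⟨v, τ, ⟨⟨-, hτ⟩, hacc⟩, k, hk⟩ := hn
  -- The run up to time `n`, continued by the accepting run `τ` from time `k`.
  refine ⟨fun j => if j < n then w j else v (j - n + k),
    fun j => if j < n then ρ j else τ (j - n + k), ⟨⟨?_, fun j => ?_⟩, ?_⟩, i, ?_⟩
  · rcases Nat.eq_zero_or_pos n with rfl | hn
    · simpa [hk] using h.1
    · simpa [hn] using h.1
  · rcases lt_trichotomy (j + 1) n with hj | rfl | hj
    · simpa [hj, (Nat.lt_succ_self j).trans hj] using h.2 j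
    · simpa [hk] using h.2 j
    · have h1 : ¬ j < n := by omega
      have h2 : ¬ j + 1 < n := by omega
      have h3 : j + 1 - n + k = j - n + k + 1 := by omega
      simpa [h1, h2, h3] using hτ (j - n + k)
  · rw [frequently_atTop] at hacc ⊢
    intro a
    obtain ⟨b, hb, hbF⟩ := hacc (a + k)
    refine ⟨b - k + n, by omega, ?_⟩
    have h1 : b - k + k = b := by omega
    simpa [h1] using hbF
  · rcases hi.lt_or_eq with hi | rfl
    · simp [hi]
    · simp [hk]

theorem isPath_of_steps {ρ : ℕ → σ} (n k : ℕ)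
    (h : ∀ i < k, N.trans (ρ (n + i)) (w (n + i)) (ρ (n + i + 1))) :
    N.IsPath (ρ n) (List.ofFn fun i : Fin k => w (n + i)) (ρ (n + k)) (fun i => ρ (n + i)) := by
  refine ⟨by simp, by simp, fun i => ?_⟩
  have := h i (by simpa using i.2)
  simpa [add_assoc] using this

/-- Without an EDA pattern, two runs that agree at times `n` and `m`, the first of which returns
later on to its state at time `n`, agree in between. -/
theorem eq_of_not_hasEDA (hN : ¬ N.HasEDA) {ρ ρ' : ℕ → σ} (h : N.IsRun w ρ) (h' : N.IsRun w ρ')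
    {n m k : ℕ} (hnm : n ≤ m) (hmk : m ≤ k) (hn : ρ n = ρ' n) (hm : ρ m = ρ' m)
    (hk : ρ k = ρ n) {i : ℕ} (hni : n ≤ i) (him : i ≤ m) : ρ i = ρ' i := by
  by_contra hne
  -- A detour along `ρ'` until `m`, then back along `ρ`: a second cycle at `ρ n` with the same
  -- label.
  let τ : ℕ → σ := fun j => if j ≤ m then ρ' j else ρ j
  have hτ : ∀ j, N.trans (τ j) (w j) (τ (j + 1)) := by
    intro j
    rcases lt_trichotomy j m with hj | rfl | hj
    · simpa [τ, hj.le, Nat.succ_le_of_lt hj] using h'.2 j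
    · simpa [τ, ← hm] using h.2 j
    · have h1 : ¬ j ≤ m := by omega
      have h2 : ¬ j + 1 ≤ m := by omega
      simpa [τ, h1, h2] using h.2 j
  obtain ⟨l, rfl⟩ := Nat.exists_eq_add_of_le (hnm.trans hmk)
  have p1 := isPath_of_steps (N := N) (w := w) (ρ := ρ) n l fun i _ => h.2 _
  have p2 := isPath_of_steps (N := N) (w := w) (ρ := τ) n l fun i _ => hτ _
  have e1 : τ n = ρ n := by simp [τ, hnm, hn]
  have e2 : τ (n + l) = ρ (n + l) := by
    by_cases hl : n + l ≤ m
    · have : n + l = m := by omega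
      simp [τ, this, hm]
    · simp [τ, hl]
  rw [hk] at p1
  rw [e1, e2, hk] at p2
  refine hN ⟨_, _, _, _, fun heq => hne ?_, p1, p2⟩
  have := congrFun heq ⟨i - n, by simp; omega⟩
  simpa [Nat.add_sub_cancel' hni, τ, him] using this

/-- There are at most `Nat.card σ` such runs: among more, at a time when all have separated, two
share a state. They also agree at `n`, and returning to `ρ n` later closes two different cycles. -/
theorem finite_runs_of_not_hasEDA [Finite σ] (hN : ¬ N.HasEDA) (n : ℕ) (x : Fin (n + 1) → σ) :
    {ρ | N.IsRun w ρ ∧ (∀ i : Fin (n + 1), ρ i = x i) ∧ ∃ᶠ k in atTop, ρ k = ρ n}.Finite := by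
  by_contra hinf
  obtain ⟨t, ht, hcard⟩ := Set.Infinite.exists_subset_card_eq hinf (Nat.card σ + 1)
  have hsep : ∀ᶠ m in atTop, ∀ ρ ∈ t, ∀ ρ' ∈ t, ρ ≠ ρ' → ∃ i ≤ m, ρ i ≠ ρ' i := by
    rw [eventually_all_finset]
    intro ρ _
    rw [eventually_all_finset]
    intro ρ' _
    by_cases h : ρ = ρ'
    · simp [h]
    · obtain ⟨i, hi⟩ := Function.ne_iff.1 h
      filter_upwards [eventually_ge_atTop i] with m hm _
      exact ⟨i, hm, hi⟩
  obtain ⟨m, hm, hnm⟩ := (hsep.and (eventually_ge_atTop n)).exists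
  let := Fintype.ofFinite σ
  obtain ⟨ρ, hρ, ρ', hρ', hne, heq⟩ := Finset.exists_ne_map_eq_of_card_lt_of_maps_to
    (s := t) (t := Finset.univ) (f := fun ρ : ℕ → σ => ρ m)
    (by rw [hcard, Finset.card_univ, Nat.card_eq_fintype_card]; omega) (by simp)
  obtain ⟨i, him, hi⟩ := hm ρ hρ ρ' hρ' hne
  obtain ⟨h1, h2, h3⟩ := ht hρ
  obtain ⟨h1', h2', -⟩ := ht hρ'
  obtain ⟨k, hk, hkn⟩ := frequently_atTop.1 h3 m
  have agree : ∀ j ≤ n, ρ j = ρ' j := fun j hj =>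
    (h2 ⟨j, by omega⟩).trans (h2' ⟨j, by omega⟩).symm
  rcases le_total i n with hin | hin
  · exact hi (agree i hin)
  · exact hi (eq_of_not_hasEDA hN h1 h1' hnm hk (agree n le_rfl) heq hkn hin him)

/-- A finite automaton without an EDA pattern has only countably many runs on every word. -/
theorem countable_runs_of_not_hasEDA [Finite σ] (hN : ¬ N.HasEDA) (w : ℕ → α) :
    {ρ | N.IsRun w ρ}.Countable := by
  refine (Set.countable_iUnion fun n => Set.countable_iUnion fun x =>
    (finite_runs_of_not_hasEDA (w := w) hN n x).countable).mono fun ρ hρ => ?_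
  -- Some state recurs forever; the prefix up to one of its visits indexes the run.
  obtain ⟨q, hq⟩ : ∃ q, ∃ᶠ k in atTop, ρ k = q := by
    by_contra hcon
    simp only [not_exists, not_frequently] at hcon
    obtain ⟨k, hk⟩ := (eventually_all.2 hcon).exists
    exact hk _ rfl
  obtain ⟨n, hn⟩ := hq.exists
  simp only [Set.mem_iUnion]
  exact ⟨n, fun i => ρ i, hρ, fun _ => rfl, by rwa [hn]⟩

end BuchiAutomaton

/-! ### The run measure -/

/-- The sequences that agree with `x` up to time `n`. -/
def prefixCylinder {σ : Type*} (x : ℕ → σ) (n : ℕ) : Set (ℕ → σ) :=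
  {ρ | ∀ i ≤ n, ρ i = x i}

theorem antitone_prefixCylinder {σ : Type*} (x : ℕ → σ) : Antitone (prefixCylinder x) :=
  fun _ _ h _ hρ i hi => hρ i (hi.trans h)

theorem measurableSet_prefixCylinder {σ : Type*} [MeasurableSpace σ] [MeasurableSingletonClass σ]
    (x : ℕ → σ) (n : ℕ) : MeasurableSet (prefixCylinder x n) := by
  have : prefixCylinder x n = ⋂ i, ⋂ (_ : i ≤ n), (fun ρ : ℕ → σ => ρ i) ⁻¹' {x i} := by
    ext ρ; simp [prefixCylinder]
  rw [this]
  exact MeasurableSet.iInter fun i => MeasurableSet.iInter fun _ =>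
    measurable_pi_apply i (measurableSet_singleton _)

theorem iInter_prefixCylinder {σ : Type*} (x : ℕ → σ) : ⋂ n, prefixCylinder x n = {x} := by
  ext ρ
  simp only [Set.mem_iInter, Set.mem_singleton_iff]
  exact ⟨fun h => funext fun n => h n n le_rfl, fun h => h ▸ fun n i _ => rfl⟩

theorem prefixCylinder_eq_preimage {σ : Type*} (x : ℕ → σ) (n : ℕ) :
    prefixCylinder x n = Preorder.frestrictLe (π := fun _ => σ) n ⁻¹' {Preorder.frestrictLe n x} := by
  ext ρ
  exact ⟨fun h => funext fun i => h i (Finset.mem_Iic.1 i.2), fun h i hi =>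
    congrFun (Set.mem_singleton_iff.1 h) ⟨i, Finset.mem_Iic.2 hi⟩⟩

namespace PBA

variable {α σ : Type*} [MeasurableSpace σ] [DiscreteMeasurableSpace σ] (A : PBA α σ)
  (w : ℕ → α)

instance : IsProbabilityMeasure (A.runMeasure w) := by
  unfold runMeasure; infer_instance

/-- Additivity needs only `T` measurable, so `S` can be the set of accepting runs without a
measurability proof. -/
theorem exists_mem_of_runMeasure_eq_one {S T : Set (ℕ → σ)} (hS : A.runMeasure w S = 1)
    (hT : MeasurableSet T) (hpos : 0 < A.runMeasure w T) : (S ∩ T).Nonempty := by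
  by_contra hcon
  have hd : Disjoint S T := Set.disjoint_iff_inter_eq_empty.2 (Set.not_nonempty_iff_eq_empty.1 hcon)
  have h1 : A.runMeasure w (S ∪ T) ≤ 1 := prob_le_one
  rw [measure_union hd hT, hS] at h1
  have h2 : (1 : ENNReal) + A.runMeasure w T ≤ 1 + 0 := by simpa using h1
  exact absurd (ENNReal.le_of_add_le_add_left ENNReal.one_ne_top h2) hpos.not_ge

theorem runMeasure_eq_one_of_compl {S : Set (ℕ → σ)} (hS : A.runMeasure w Sᶜ = 0) :
    A.runMeasure w S = 1 := by
  refine le_antisymm prob_le_one ?_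
  have h := measure_union_le (μ := A.runMeasure w) S Sᶜ
  rwa [Set.union_compl_self, measure_univ, hS, add_zero] at h

variable [Finite σ]

theorem runMeasure_prefixCylinder_zero (x : ℕ → σ) :
    A.runMeasure w (prefixCylinder x 0) = A.init (x 0) := by
  have h0 : (A.runMeasure w).map (Preorder.frestrictLe 0) =
      A.init.toMeasure.map (MeasurableEquiv.piUnique fun _ : Finset.Iic 0 => σ).symm := by
    rw [runMeasure, Kernel.trajMeasure, Measure.map_comp _ _ (by fun_prop),
      Kernel.traj_map_frestrictLe, Kernel.partialTraj_self, Measure.id_comp]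
  rw [prefixCylinder_eq_preimage, ← Measure.map_apply (by fun_prop) (measurableSet_singleton _), h0,
    MeasurableEquiv.map_apply, ← PMF.toMeasure_apply_singleton _ _ (measurableSet_singleton _)]
  congr 1
  ext q
  simp only [Set.mem_preimage, Set.mem_singleton_iff]
  constructor
  · intro h
    exact congrFun h ⟨0, by simp⟩
  · rintro rfl
    ext ⟨i, hi⟩
    obtain rfl : i = 0 := by simpa using hi
    rfl

/-- The joint law of the history up to `n` and the next state is a composition-product with
`stepKernel`, evaluated here at one point. -/
theorem runMeasure_prefixCylinder_succ (x : ℕ → σ) (n : ℕ) :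
    A.runMeasure w (prefixCylinder x (n + 1)) =
      A.runMeasure w (prefixCylinder x n) * A.step (x n) (w n) (x (n + 1)) := by
  have h2 : prefixCylinder x (n + 1) =
      (fun ρ : ℕ → σ => (Preorder.frestrictLe (π := fun _ => σ) n ρ, ρ (n + 1))) ⁻¹'
        ({Preorder.frestrictLe n x} ×ˢ {x (n + 1)}) := by
    have : prefixCylinder x (n + 1) = prefixCylinder x n ∩ {ρ | ρ (n + 1) = x (n + 1)} := by
      ext ρ
      simp only [prefixCylinder, Set.mem_inter_iff, Set.mem_ofPred_eq]
      exact ⟨fun h => ⟨fun i hi => h i (by omega), h _ le_rfl⟩, fun h i hi =>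
        (Nat.le_succ_iff.1 hi).elim (h.1 i) fun e => e ▸ h.2⟩
    rw [this, prefixCylinder_eq_preimage]
    rfl
  have h3 := Kernel.map_frestrictLe_trajMeasure_compProd_eq_map_trajMeasure (X := fun _ => σ)
    (μ₀ := A.init.toMeasure) (κ := A.stepKernel w) (a := n)
  change (A.runMeasure w).map _ ⊗ₘ _ = (A.runMeasure w).map _ at h3
  rw [h2, ← Measure.map_apply (by fun_prop)
    ((measurableSet_singleton _).prod (measurableSet_singleton _)), ← h3,
    Measure.compProd_apply_prod (measurableSet_singleton _) (measurableSet_singleton _),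
    lintegral_singleton, Measure.map_apply (by fun_prop) (measurableSet_singleton _), ← prefixCylinder_eq_preimage,
    mul_comm]
  congr 1
  exact PMF.toMeasure_apply_singleton _ _ (measurableSet_singleton _)

theorem runMeasure_prefixCylinder_pos {x : ℕ → σ} {n : ℕ} (h0 : x 0 ∈ A.underlying.init)
    (hs : ∀ i < n, A.underlying.trans (x i) (w i) (x (i + 1))) :
    0 < A.runMeasure w (prefixCylinder x n) := by
  induction n with
  | zero => rw [runMeasure_prefixCylinder_zero]; exact h0
  | succ n ih =>
    rw [runMeasure_prefixCylinder_succ]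
    exact ENNReal.mul_pos (ih fun i hi => hs i (by omega)).ne' (hs n (by omega)).ne'

theorem runMeasure_not_isRun : A.runMeasure w {ρ | ¬ A.underlying.IsRun w ρ} = 0 := by
  have h0 : A.runMeasure w {ρ | ρ 0 ∉ A.underlying.init} = 0 := by
    have : {ρ : ℕ → σ | ρ 0 ∉ A.underlying.init} ⊆
        ⋃ q : {q : σ // q ∉ A.underlying.init}, prefixCylinder (fun _ => q) 0 := by
      intro ρ hρ
      exact Set.mem_iUnion.2 ⟨⟨ρ 0, hρ⟩, fun i hi => by rw [Nat.le_zero.1 hi]⟩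
    refine measure_mono_null this (measure_iUnion_null fun q => ?_)
    rw [runMeasure_prefixCylinder_zero]
    simpa [underlying] using q.2
  have hs : ∀ n, A.runMeasure w {ρ | ¬ A.underlying.trans (ρ n) (w n) (ρ (n + 1))} = 0 := by
    intro n
    -- The padding value `x 0` is irrelevant; finitely many null cylinders cover the set.
    let ext : (Fin (n + 2) → σ) → ℕ → σ := fun x i => if h : i < n + 2 then x ⟨i, h⟩ else x 0
    have : {ρ : ℕ → σ | ¬ A.underlying.trans (ρ n) (w n) (ρ (n + 1))} ⊆
        ⋃ x : {x : Fin (n + 2) → σ // ¬ A.underlying.trans (ext x n) (w n) (ext x (n + 1))},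
          prefixCylinder (ext x) (n + 1) := by
      intro ρ hρ
      refine Set.mem_iUnion.2 ⟨⟨fun i => ρ i, by simpa [ext] using hρ⟩, fun i hi => ?_⟩
      simp [ext, Nat.lt_succ_of_le hi]
    refine measure_mono_null this (measure_iUnion_null fun x => ?_)
    rw [runMeasure_prefixCylinder_succ, mul_eq_zero]
    right
    simpa [underlying] using x.2
  refine measure_mono_null (t := {ρ | ρ 0 ∉ A.underlying.init} ∪
    ⋃ n, {ρ | ¬ A.underlying.trans (ρ n) (w n) (ρ (n + 1))}) ?_
    (measure_union_null h0 (measure_iUnion_null hs))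
  intro ρ hρ
  by_contra hcon
  simp only [Set.mem_union, Set.mem_iUnion, Set.mem_ofPred_eq, not_or, not_exists, not_not] at hcon
  exact hρ hcon

theorem tendsto_runMeasure_prefixCylinder (x : ℕ → σ) :
    Tendsto (fun n => A.runMeasure w (prefixCylinder x n)) atTop
      (nhds (A.runMeasure w {x})) := by
  rw [← iInter_prefixCylinder x]
  exact tendsto_measure_iInter_atTop
    (fun n => (measurableSet_prefixCylinder x n).nullMeasurableSet)
    (antitone_prefixCylinder x) ⟨0, measure_ne_top _ _⟩

theorem runMeasure_singleton_pos {ρ : ℕ → σ} (h : A.underlying.IsRun w ρ)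
    (hdet : ∀ᶠ i in atTop, A.step (ρ i) (w i) (ρ (i + 1)) = 1) :
    0 < A.runMeasure w {ρ} := by
  obtain ⟨m, hm⟩ := eventually_atTop.1 hdet
  have hconst : ∀ k, A.runMeasure w (prefixCylinder ρ (m + k)) =
      A.runMeasure w (prefixCylinder ρ m) := by
    intro k
    induction k with
    | zero => rfl
    | succ k ih =>
      rw [← add_assoc, runMeasure_prefixCylinder_succ, ih, hm _ (by omega), mul_one]
  have ht := ((tendsto_runMeasure_prefixCylinder A w ρ).comp (tendsto_add_atTop_nat m))
  have : (fun n => A.runMeasure w (prefixCylinder ρ n)) ∘ (fun k => k + m) =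
      fun _ => A.runMeasure w (prefixCylinder ρ m) := by
    funext k
    simp [add_comm k m, hconst]
  rw [this] at ht
  rw [tendsto_nhds_unique ht tendsto_const_nhds]
  exact A.runMeasure_prefixCylinder_pos w h.1 fun i _ => h.2 i

theorem runMeasure_singleton_eq_zero [Finite α] {ρ : ℕ → σ}
    (hdet : ∃ᶠ i in atTop, A.step (ρ i) (w i) (ρ (i + 1)) ≠ 1) :
    A.runMeasure w {ρ} = 0 := by
  -- There are finitely many transitions, so the probabilities other than `1` have a maximum below
  -- `1`.
  obtain ⟨c, hc, hle⟩ : ∃ c < 1, ∀ p a q, A.step p a q ≠ 1 → A.step p a q ≤ c := by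
    let := Fintype.ofFinite α
    let := Fintype.ofFinite σ
    classical
    refine ⟨(Finset.univ.filter fun t : σ × α × σ => A.step t.1 t.2.1 t.2.2 ≠ 1).sup
      fun t => A.step t.1 t.2.1 t.2.2, ?_, fun p a q h => ?_⟩
    · rw [Finset.sup_lt_iff (by simp)]
      intro t ht
      exact lt_of_le_of_ne (PMF.coe_le_one _ _) (Finset.mem_filter.1 ht).2
    · exact Finset.le_sup (f := fun t : σ × α × σ => A.step t.1 t.2.1 t.2.2) (b := (p, a, q))
        (by simpa using h)
  have ht := tendsto_runMeasure_prefixCylinder A w ρ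
  have hlow : ∀ n, A.runMeasure w {ρ} ≤ A.runMeasure w (prefixCylinder ρ n) := fun n =>
    measure_mono (by rw [← iInter_prefixCylinder ρ]; exact Set.iInter_subset _ n)
  -- Infinitely often a step shrinks the cylinder by a factor of at most `c`; this passes to the
  -- limit.
  have hle' : A.runMeasure w {ρ} ≤ A.runMeasure w {ρ} * c := by
    have h1 : Tendsto (fun n => A.runMeasure w (prefixCylinder ρ n) * c) atTop
        (nhds (A.runMeasure w {ρ} * c)) :=
      ENNReal.Tendsto.mul_const ht (Or.inr (hc.trans ENNReal.one_lt_top).ne)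
    refine ge_of_tendsto_of_frequently h1 (hdet.mono fun n hn => ?_)
    refine (hlow (n + 1)).trans ?_
    rw [runMeasure_prefixCylinder_succ]
    gcongr
    exact hle _ _ _ hn
  by_contra hne
  have : A.runMeasure w {ρ} * c < A.runMeasure w {ρ} * 1 :=
    ENNReal.mul_lt_mul_right hne (measure_ne_top _ _) hc
  rw [mul_one] at this
  exact absurd hle' this.not_ge

end PBA

/-! ### The main theorem -/

namespace PBA

variable {α σ : Type*} [Finite σ] {A : PBA α σ}

/-- If there are only finitely many accepting runs on every word, then a word is accepted almost
surely if and only if all runs on it are accepting. -/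
theorem mem_almostSureLanguage_iff_of_ambiguity (hA : A.AtMostExponentiallyAmbiguous)
    (w : ℕ → α) : w ∈ A.almostSureLanguage ↔
      ¬ ∃ ρ, A.underlying.IsRun w ρ ∧ ∀ᶠ i in atTop, ρ i ∉ A.underlying.final := by
  let _ : MeasurableSpace σ := ⊤
  have _ : DiscreteMeasurableSpace σ := ⟨fun _ => trivial⟩
  change A.runMeasure w _ = 1 ↔ _
  constructor
  · rintro h ⟨ρ, hρ, hnot⟩
    -- Accepting runs visit only useful states, so they all come from the trimmed automaton.
    have hfin : (A.underlying.acceptingRuns w).Finite := by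
      refine ((hA w).image fun (τ : ℕ → {q // A.underlying.IsUseful q}) i => (τ i).1).subset
        fun τ hτ => ⟨fun i => ⟨τ i, w, τ, hτ, i, rfl⟩, hτ, rfl⟩
    have hex : ∀ n, ∃ τ ∈ A.underlying.acceptingRuns w, τ ∈ prefixCylinder ρ n := fun n =>
      A.exists_mem_of_runMeasure_eq_one w h (measurableSet_prefixCylinder ρ n)
        (A.runMeasure_prefixCylinder_pos w hρ.1 fun i _ => hρ.2 i)
    obtain ⟨τ, hτ, hfreq⟩ : ∃ τ ∈ A.underlying.acceptingRuns w,
        ∃ᶠ n in atTop, τ ∈ prefixCylinder ρ n := by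
      by_contra hcon
      push Not at hcon
      obtain ⟨n, hn⟩ := ((eventually_all_finite hfin).2 hcon).exists
      obtain ⟨τ, hτ, hτn⟩ := hex n
      exact hn τ hτ hτn
    have : τ = ρ := by
      funext i
      obtain ⟨n, hin, hn⟩ := frequently_atTop.1 hfreq i
      exact hn i hin
    exact (this ▸ hτ.2) hnot
  · intro h
    refine A.runMeasure_eq_one_of_compl w
      (measure_mono_null (fun ρ hρ => ?_) (A.runMeasure_not_isRun w))
    exact fun hrun => hρ ⟨hrun, fun hnot => h ⟨ρ, hrun, hnot⟩⟩

/-- For a flat automaton, a word is accepted almost surely if and only if there is no run on it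
that eventually uses only transitions that have probability `1` and start in a nonfinal state, or
start in a useless state. -/
theorem mem_almostSureLanguage_iff_of_isFlat [Finite α] (hA : A.IsFlat)
    (w : ℕ → α) : w ∈ A.almostSureLanguage ↔
      ¬ ∃ ρ, A.underlying.IsRun w ρ ∧ ∀ᶠ i in atTop,
        (A.step (ρ i) (w i) (ρ (i + 1)) = 1 ∧ ρ i ∉ A.underlying.final) ∨
          ¬ A.underlying.IsUseful (ρ i) := by
  let _ : MeasurableSpace σ := ⊤
  have _ : DiscreteMeasurableSpace σ := ⟨fun _ => trivial⟩
  change A.runMeasure w _ = 1 ↔ _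
  constructor
  · rintro h ⟨ρ, hρ, hD⟩
    have huse : ∀ n, A.underlying.IsUseful (ρ n) := by
      intro n
      obtain ⟨τ, hτ, hτn⟩ := A.exists_mem_of_runMeasure_eq_one w h
        (measurableSet_prefixCylinder ρ n)
        (A.runMeasure_prefixCylinder_pos w hρ.1 fun i _ => hρ.2 i)
      exact ⟨w, τ, hτ, n, hτn n le_rfl⟩
    have hD' : ∀ᶠ i in atTop,
        A.step (ρ i) (w i) (ρ (i + 1)) = 1 ∧ ρ i ∉ A.underlying.final :=
      hD.mono fun i hi => hi.resolve_right (not_not.2 (huse i))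
    -- The run `ρ` is an atom, so a set of probability `1` must contain it.
    obtain ⟨τ, hτ, rfl⟩ := A.exists_mem_of_runMeasure_eq_one w h (measurableSet_singleton ρ)
      (A.runMeasure_singleton_pos w hρ (hD'.mono fun i hi => hi.1))
    exact hτ.2 (hD'.mono fun i hi => hi.2)
  · intro h
    -- Once useless, a run stays useless and so satisfies the forbidden condition.
    have huse : ∀ ρ, A.underlying.IsRun w ρ → ∀ n, A.underlying.IsUseful (ρ n) := by
      intro ρ hρ n
      by_contra hn
      refine h ⟨ρ, hρ, eventually_atTop.2 ⟨n, fun i hi => Or.inr fun hu => hn ?_⟩⟩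
      exact BuchiAutomaton.IsRun.isUseful_of_le hρ hi hu
    have hcount : {ρ | A.underlying.IsRun w ρ}.Countable := by
      refine ((BuchiAutomaton.countable_runs_of_not_hasEDA hA w).image
        fun (τ : ℕ → {q // A.underlying.IsUseful q}) i => (τ i).1).mono fun ρ hρ => ?_
      exact ⟨fun i => ⟨ρ i, huse ρ hρ i⟩, hρ, rfl⟩
    refine A.runMeasure_eq_one_of_compl w (measure_mono_null
      (t := {ρ | ¬ A.underlying.IsRun w ρ} ∪
        ⋃ ρ ∈ {ρ | A.underlying.IsRun w ρ} \ A.underlying.acceptingRuns w, {ρ}) (fun ρ hρ => ?_)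
      (measure_union_null (A.runMeasure_not_isRun w)
        ((measure_biUnion_null_iff (hcount.mono Set.sdiff_subset)).2 ?_)))
    · by_cases hrun : A.underlying.IsRun w ρ
      · exact Or.inr (Set.mem_biUnion (x := ρ) ⟨hrun, hρ⟩ rfl)
      · exact Or.inl hrun
    · rintro ρ ⟨hrun, hρ⟩
      refine A.runMeasure_singleton_eq_zero w fun hdet => h ⟨ρ, hrun, ?_⟩
      have hnot : ∀ᶠ i in atTop, ρ i ∉ A.underlying.final := by
        by_contra hcon
        exact hρ ⟨hrun, hcon⟩
      filter_upwards [hdet, hnot] with i h1 h2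
      exact Or.inl ⟨not_not.1 h1, h2⟩

end PBA

theorem mainTheorem2 {α σ : Type*} [Finite α] [Finite σ] (A : PBA α σ)
    (hA : A.AtMostExponentiallyAmbiguous ∨ A.IsFlat) :
    IsOmegaRegular A.almostSureLanguage ∧ IsDBARecognizable A.almostSureLanguage := by
  suffices h : IsDBARecognizable A.almostSureLanguage from ⟨h.isOmegaRegular, h⟩
  rcases hA with hA | hA
  · convert A.underlying.isDBARecognizable_forall_run fun p _ _ => p ∉ A.underlying.final
    exact Set.ext (PBA.mem_almostSureLanguage_iff_of_ambiguity hA)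
  · convert A.underlying.isDBARecognizable_forall_run fun p a q =>
      (A.step p a q = 1 ∧ p ∉ A.underlying.final) ∨ ¬ A.underlying.IsUseful p
    exact Set.ext (PBA.mem_almostSureLanguage_iff_of_isFlat hA)
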